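/- Let $m,u\ge 1$ be integers, $n=m+u$, let $z_1,\dots,z_n\in\mathcal X\times\mathcal Y$ be a full sample, and let $\mathcal H$ be a non-empty class of functions $h:\mathcal X\times\mathcal Y\to\mathbb R$; write $h(i)=h(z_i)$, $\mathcal L_n(h)=\frac1n\sum_{i=1}^n h(i)$, $T_n(h)=\frac1n\sum_{i=1}^n h(i)^2$. Let $\mathbf d=(d_1,\dots,d_u)$ have independent coordinates, $d_i$ uniform on $\{i,\dots,n\}$, and let $\mathbf Z_{\mathbf d}=(\mathbf Z_{\mathbf d}(1),\dots,\mathbf Z_{\mathbf d}(u))$ be the output of the algorithm RANDPERM: start with the array $\mathbf I=(1,\dots,n)$ and, for $i=1,\dots,u$, put $\mathbf Z_{\mathbf d}(i)=\mathbf I(d_i)$ and then swap the values $\mathbf I(i)$ and $\mathbf I(d_i)$. (Thus the set $\{\mathbf Z_{\mathbf d}\}$ of test indices is a uniformly random $u$-element subset of $\{1,\dots,n\}$; its complement $\overline{\mathbf Z_{\mathbf d}}$ is the set of the $m$ training indices.) Put $$\mathcal U_h^{(u)}(\mathbf Z_{\mathbf d})=\frac1u\sum_{i\in\{\mathbf Z_{\mathbf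 d}\}}h(i),\qquad \mathcal L_h^{(m)}(\overline{\mathbf Z_{\mathbf d}})=\frac1m\sum_{i\in\overline{\mathbf Z_{\mathbf d}}}h(i),\qquad g_u(\mathbf d)=\sup_{h\in\mathcal H}\mathcal U_h^{(u)}(\mathbf Z_{\mathbf d}).$$ For a class $\mathcal H'$ of functions define the transductive complexities $$\mathfrak R_u^+(\mathcal H')=\mathbb E_{\mathbf d}\Big[\sup_{h\in\mathcal H'}\big(\mathcal U_h^{(u)}(\mathbf Z_{\mathbf d})-\mathcal L_n(h)\big)\Big],\qquad \mathfrak R_m^+(\mathcal H')=\mathbb E_{\mathbf d}\Big[\sup_{h\in\mathcal H'}\big(\mathcal L_h^{(m)}(\overline{\mathbf Z_{\mathbf d}})-\mathcal L_n(h)\big)\Big],$$ and let $\mathfrak R^+_{\min\{u,m\}}$ be $\mathfrak R_u^+$ if $u\le m$ and $\mathfrak R_m^+$ otherwise (for $u=m$ the two coincide). Let $\mathcal H_1=\{h^2: h\in\mathcal H\}$. Suppose that $H_0\ge 2\sqrt2$ and that for all $h\in\mathcal H$: $\mathcal L_n(h)=0$, $|h(i)|\le H_0$ for all $i\in\{1,\dots,n\}$,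 and $T_n(h)\le r$. Then for every $x>0$, with probability at least $1-e^{-x}$ over $\mathbf d$, $$g_u(\mathbf d)-\mathbb E_{\mathbf d}[g_u(\mathbf d)]\le\frac{4m}{n}\left(2\sqrt{\frac{3rx}{\min\{u,m\}}}+\inf_{\alpha>0}\left(\frac{\mathfrak R^+_{\min\{u,m\}}(\mathcal H_1)}{\alpha}+\frac{\alpha x}{\min\{u,m\}}\right)+\frac{2H_0^2x}{\min\{u,m\}}\right).$$ -/

import Mathlib

open MeasureTheory ProbabilityTheory

noncomputable section

namespace Transductive

/-- The vectors `d = (d_1, …, d_u)` with `d_i ∈ [i : n]`, where `n = m + u`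
(positions are numbered from `0`). -/
abbrev Draws (m u : ℕ) : Type :=
  (i : Fin u) → {k : Fin (m + u) // Fin.castLE (Nat.le_add_left u m) i ≤ k}

/-- The law of `d`: the coordinates are independent and `d_i` is uniform on `[i : n]`. -/
def drawLaw (m u : ℕ) : Measure (Draws m u) :=
  Measure.pi fun _ => uniformOn Set.univ

instance instIsProbabilityMeasureDrawLaw (m u : ℕ) : IsProbabilityMeasure (drawLaw m u) := by
  have h : ∀ i : Fin u, IsProbabilityMeasure
      (uniformOn (Set.univ : Set {k : Fin (m + u) //
        Fin.castLE (Nat.le_add_left u m) i ≤ k})) := fun i =>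
    isProbabilityMeasure_uniformOn Set.finite_univ ⟨⟨_, le_refl _⟩, Set.mem_univ _⟩
  unfold drawLaw
  infer_instance

/-- The array `I` of RANDPERM after `k` rounds: it starts as `I = [n]`, and in the round `i` the
values `I(i)` and `I(d_i)` are swapped. -/
def randPermArray {m u : ℕ} (d : Draws m u) : ℕ → Equiv.Perm (Fin (m + u))
  | 0 => 1
  | k + 1 =>
    if hk : k < u then
      randPermArray d k * Equiv.swap (Fin.castLE (Nat.le_add_left u m) ⟨k, hk⟩) (d ⟨k, hk⟩).1
    else randPermArray d k

/-- The output `Z_d` of RANDPERM: `Z_d(i) = I(d_i)`, read off just before the swap of round `i`. -/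
def randPerm {m u : ℕ} (d : Draws m u) (i : Fin u) : Fin (m + u) :=
  randPermArray d i (d i).1

/-- The set `{Z_d}` of indices of the test points. -/
def testIdx {m u : ℕ} (d : Draws m u) : Finset (Fin (m + u)) :=
  Finset.univ.image (randPerm d)

/-- The set of indices of the training points, the complement of `{Z_d}`. -/
def trainIdx {m u : ℕ} (d : Draws m u) : Finset (Fin (m + u)) :=
  (testIdx d)ᶜ

/-- `L_n(h) = (1/n) ∑ h(i)`, where `h(i)` is the value of `h` at the `i`-th sample point `z i`. -/
def fullAvg {S : Type*} {m u : ℕ} (z : Fin (m + u) → S) (h : S → ℝ) : ℝ :=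
  (1 / ((m + u : ℕ) : ℝ)) * ∑ i, h (z i)

/-- `T_n(h) = (1/n) ∑ h(i)²`. -/
def fullSqAvg {S : Type*} {m u : ℕ} (z : Fin (m + u) → S) (h : S → ℝ) : ℝ :=
  (1 / ((m + u : ℕ) : ℝ)) * ∑ i, h (z i) ^ 2

/-- The test average `U_h^{(u)}(Z_d)`. -/
def testAvg {S : Type*} {m u : ℕ} (z : Fin (m + u) → S) (d : Draws m u) (h : S → ℝ) : ℝ :=
  (1 / (u : ℝ)) * ∑ i ∈ testIdx d, h (z i)

/-- The training average `L_h^{(m)}` over the complement of `{Z_d}`. -/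
def trainAvg {S : Type*} {m u : ℕ} (z : Fin (m + u) → S) (d : Draws m u) (h : S → ℝ) : ℝ :=
  (1 / (m : ℝ)) * ∑ i ∈ trainIdx d, h (z i)

/-- The supremum `g_u(d)` of the test averages over the class `H`. -/
def supTest {S : Type*} {m u : ℕ} (z : Fin (m + u) → S) (H : Set (S → ℝ)) (d : Draws m u) : ℝ :=
  ⨆ h : H, testAvg z d h.1

/-- The transductive complexity `R_u^+(H)`. -/
def testComplexity {S : Type*} {m u : ℕ} (z : Fin (m + u) → S) (H : Set (S → ℝ)) : ℝ :=
  ∫ d : Draws m u, (⨆ h : H, (testAvg z d h.1 - fullAvg z h.1)) ∂(drawLaw m u)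

/-- The transductive complexity `R_m^+(H)`. -/
def trainComplexity {S : Type*} {m u : ℕ} (z : Fin (m + u) → S) (H : Set (S → ℝ)) : ℝ :=
  ∫ d : Draws m u, (⨆ h : H, (trainAvg z d h.1 - fullAvg z h.1)) ∂(drawLaw m u)

/-- The transductive complexity `R_{min(u,m)}^+(H)`. For `u = m` the two complexities agree, since
test set and training set then have the same law. -/
def minComplexity {S : Type*} {m u : ℕ} (z : Fin (m + u) → S) (H : Set (S → ℝ)) : ℝ :=
  if u ≤ m then testComplexity z H else trainComplexity z H

/-- The class `H_1 = {h² : h ∈ H}`. -/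
def squareClass {S : Type*} (H : Set (S → ℝ)) : Set (S → ℝ) :=
  {f | ∃ h ∈ H, f = fun p => h p ^ 2}

end Transductive

end

/-!
The proof is the entropy method for the uniform law on the `k`-element subsets `S` of a finite type.
Sampling without replacement satisfies a modified logarithmic Sobolev inequality for the dynamics
that exchange an element of `S` with an element of `Sᶜ`, so the entropy of `exp (t Z)` is controlled
by the average of `exp (t Z) * exchangeVar Z`. If `Z` is the supremum of the averages over `S`, then
`exchangeVar Z` is, up to constants, at most `Q + r`, where `Q` is the supremum of the averages of
the squares, and `Q` is self-bounding: `exchangeVar Q ≤ B * Q`. The Gibbs variational formula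
decouples `Q` from `exp (t Z)`, after which Herbst's argument and Chernoff's bound give the tail
of `Z`.

Bounding `exchangeVar` compares averages over `Sᶜ` with averages over the whole population, which
costs a factor `2` if `S` is at most half of it. If the test set is larger than that, `L_n(h) = 0`
lets its averages be replaced by multiples of the averages of `-h` over the training set.
-/

noncomputable section

namespace Transductive

open Finset
open scoped BigOperators Pointwise

section Herbst

theorem hasDerivAt_dslope_zero {ψ : ℝ → ℝ} {t : ℝ} (hψ₀ : ψ 0 = 0) (ht : t ≠ 0)
    (hψ : DifferentiableAt ℝ ψ t) :
    HasDerivAt (dslope ψ 0) ((t * deriv ψ t - ψ t) / t ^ 2) t := by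
  have hdiv : HasDerivAt (fun s => ψ s / s) ((t * deriv ψ t - ψ t) / t ^ 2) t :=
    (hψ.hasDerivAt.div (hasDerivAt_id' t) ht).congr_deriv (by ring)
  refine hdiv.congr_of_eventuallyEq ?_
  filter_upwards [dslope_eventuallyEq_slope_of_ne ψ ht] with s hs
  rw [hs, slope_def_field, hψ₀, sub_zero, sub_zero]

theorem le_mul_deriv_zero_add {ψ c : ℝ → ℝ} {T : ℝ} (hT : 0 < T) (hψ₀ : ψ 0 = 0)
    (hc₀ : c 0 = 0) (hψ : ∀ t ∈ Set.Icc 0 T, DifferentiableAt ℝ ψ t)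
    (hc : ∀ t ∈ Set.Icc 0 T, DifferentiableAt ℝ c t)
    (h : ∀ t ∈ Set.Ioo 0 T, t * deriv ψ t - ψ t ≤ t ^ 2 * deriv c t) :
    ψ T ≤ T * (deriv ψ 0 + c T) := by
  have hderiv (t : ℝ) (ht : t ∈ Set.Ioo 0 T) : HasDerivAt (fun t => dslope ψ 0 t - c t)
      ((t * deriv ψ t - ψ t) / t ^ 2 - deriv c t) t :=
    (hasDerivAt_dslope_zero hψ₀ ht.1.ne' (hψ t (Set.Ioo_subset_Icc_self ht))).sub
      (hc t (Set.Ioo_subset_Icc_self ht)).hasDerivAt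
  have hanti : AntitoneOn (fun t => dslope ψ 0 t - c t) (Set.Icc 0 T) := by
    refine antitoneOn_of_deriv_nonpos (convex_Icc 0 T) (fun t ht => ?_) ?_ ?_
    · refine ContinuousAt.continuousWithinAt (.sub ?_ (hc t ht).continuousAt)
      rcases eq_or_ne t 0 with rfl | ht₀
      · exact continuousAt_dslope_same.2 (hψ 0 ht)
      · exact (continuousAt_dslope_of_ne ht₀).2 (hψ t ht).continuousAt
    · rw [interior_Icc]
      exact fun t ht => (hderiv t ht).differentiableAt.differentiableWithinAt
    · rw [interior_Icc]
      intro t ht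
      rw [(hderiv t ht).deriv, sub_nonpos, div_le_iff₀' (pow_pos ht.1 2)]
      exact h t ht
  have hT₀ := hanti (Set.left_mem_Icc.2 hT.le) (Set.right_mem_Icc.2 hT.le) hT.le
  have hslope : dslope ψ 0 T = ψ T / T := by
    rw [dslope_of_ne ψ hT.ne', slope_def_field, hψ₀, sub_zero, sub_zero]
  simp only [hslope, dslope_same, hc₀, sub_zero] at hT₀
  rwa [sub_le_iff_le_add, div_le_iff₀' hT] at hT₀

end Herbst

section Cgf

variable {Ω : Type*} [MeasurableSpace Ω] {μ : Measure Ω} {Z Q : Ω → ℝ}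

theorem differentiableAt_cgf (hZ : integrableExpSet Z μ = Set.univ) (t : ℝ) :
    DifferentiableAt ℝ (cgf Z μ) t :=
  (analyticAt_cgf (by simp [hZ])).differentiableAt

/-- The relative entropy, with respect to `μ`, of the law `μ.tilted (t * Z ·)` with density
proportional to `exp (t * Z)`. -/
def tiltEntropy (Z : Ω → ℝ) (μ : Measure Ω) (t : ℝ) : ℝ :=
  t * deriv (cgf Z μ) t - cgf Z μ t

variable [IsProbabilityMeasure μ]

theorem mul_integral_tilted_le_tiltEntropy_add_cgf (hZ : integrableExpSet Z μ = Set.univ)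
    {s t : ℝ} (hs : Integrable (fun ω => Real.exp (s * Q ω)) μ)
    (hQ : Integrable Q (μ.tilted (t * Z ·))) :
    s * ∫ ω, Q ω ∂(μ.tilted (t * Z ·)) ≤ tiltEntropy Z μ t + cgf Q μ s := by
  have ht : t ∈ interior (integrableExpSet Z μ) := by simp [hZ]
  have hZt : Integrable (fun ω => Real.exp (t * Z ω)) μ :=
    interior_subset (s := integrableExpSet Z μ) ht
  have := isProbabilityMeasure_tilted hZt
  have hZν : Integrable Z (μ.tilted (t * Z ·)) := memLp_one_iff_integrable.1 (memLp_tilted_mul ht 1)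
  have hint : Integrable (fun ω => Real.exp (s * Q ω - t * Z ω)) (μ.tilted (t * Z ·)) := by
    rw [integrable_tilted_iff hZt]
    simpa [← Real.exp_add] using hs
  have hjensen : Real.exp (∫ ω, (s * Q ω - t * Z ω) ∂(μ.tilted (t * Z ·))) ≤
      ∫ ω, Real.exp (s * Q ω - t * Z ω) ∂(μ.tilted (t * Z ·)) :=
    convexOn_exp.map_integral_le Real.continuous_exp.continuousOn isClosed_univ
      (.of_forall fun _ => Set.mem_univ _) ((hQ.const_mul s).sub (hZν.const_mul t)) hint
  rw [integral_exp_tilted, integral_sub (hQ.const_mul s) (hZν.const_mul t), integral_const_mul,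
    integral_const_mul, integral_tilted_mul_self ht] at hjensen
  simp only [Pi.add_apply, add_sub_cancel] at hjensen
  have hlog := (Real.le_log_iff_exp_le (div_pos (mgf_pos hs) (mgf_pos hZt))).2 hjensen
  rw [Real.log_div (mgf_pos hs).ne' (mgf_pos hZt).ne'] at hlog
  change _ ≤ cgf Q μ s - cgf Z μ t at hlog
  rw [tiltEntropy]
  linarith

theorem cgf_mul_one_sub_le_of_tiltEntropy_le (hQ : integrableExpSet Q μ = Set.univ) {B T : ℝ}
    (h : ∀ t, 0 < t → tiltEntropy Q μ t ≤ t ^ 2 * (B * ∫ ω, Q ω ∂(μ.tilted (t * Q ·))))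
    (hT : 0 < T) : cgf Q μ T * (1 - T * B) ≤ T * μ[Q] := by
  have hherbst := le_mul_deriv_zero_add (c := fun t => B * cgf Q μ t) hT cgf_zero (by simp)
    (fun t _ => differentiableAt_cgf hQ t) (fun t _ => (differentiableAt_cgf hQ t).const_mul B)
    fun t ht => by
      rw [deriv_const_mul_field, ← integral_tilted_mul_self (X := Q) (t := t) (by simp [hQ])]
      exact (congrArg (fun y => t * y - cgf Q μ t)
        (integral_tilted_mul_self (X := Q) (t := t) (by simp [hQ]))).trans_le (h t ht.1)
  rw [deriv_cgf_zero (by simp [hQ])] at hherbst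
  simp only [probReal_univ, div_one] at hherbst
  linarith

theorem tiltEntropy_le_of_selfBounding (hZ : integrableExpSet Z μ = Set.univ)
    (hQ : integrableExpSet Q μ = Set.univ) {a b B θ t : ℝ} (ha : 0 < a) (hθ : 0 < θ)
    (haB : a * B = θ ^ 2)
    (hself : ∀ t, 0 < t → tiltEntropy Q μ t ≤ t ^ 2 * (B * ∫ ω, Q ω ∂(μ.tilted (t * Q ·))))
    (ht : 0 < t) (htθ : t * θ < 1) (hQZ : Integrable Q (μ.tilted (t * Z ·))) (hb : 0 ≤ b)
    (hent : tiltEntropy Z μ t ≤ t ^ 2 * (a * ∫ ω, Q ω ∂(μ.tilted (t * Z ·)) + b)) :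
    tiltEntropy Z μ t ≤ t ^ 2 * ((a * μ[Q] + b) / (1 - t * θ) ^ 2) := by
  have hpos : 0 < 1 - t * θ := sub_pos.2 htθ
  -- This `s` balances the two uses of self-boundedness:
  -- `s * B = t * θ` and `t * θ * s = t ^ 2 * a`.
  set s := t * a / θ with hs
  have hsB : s * B = t * θ := by rw [hs]; field_simp; linarith
  have hgibbs := mul_integral_tilted_le_tiltEntropy_add_cgf (s := s) hZ
    (show s ∈ integrableExpSet Q μ by simp [hQ]) hQZ
  have hcgf : cgf Q μ s ≤ s * μ[Q] / (1 - t * θ) := by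
    rw [le_div_iff₀ hpos, ← hsB]
    exact cgf_mul_one_sub_le_of_tiltEntropy_le hQ hself (by positivity)
  set I := ∫ ω, Q ω ∂(μ.tilted (t * Z ·))
  have hI : t ^ 2 * (a * I) ≤ t * θ * (tiltEntropy Z μ t + s * μ[Q] / (1 - t * θ)) := by
    rw [show t ^ 2 * (a * I) = t * θ * (s * I) by rw [hs]; field_simp]
    gcongr
    linarith
  have hb_div : b ≤ b / (1 - t * θ) := le_div_self hb hpos (by nlinarith)
  have hsQ : t * θ * (s * μ[Q] / (1 - t * θ)) = t ^ 2 * (a * μ[Q] / (1 - t * θ)) := by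
    rw [hs]; field_simp
  have hrec : tiltEntropy Z μ t * (1 - t * θ) ≤ t ^ 2 * ((a * μ[Q] + b) / (1 - t * θ)) := by
    rw [add_div]
    nlinarith [mul_le_mul_of_nonneg_left hb_div (sq_nonneg t)]
  rwa [← le_div_iff₀ hpos, mul_div_assoc, div_div, ← sq] at hrec

theorem cgf_le_of_tiltEntropy_le (hZ : integrableExpSet Z μ = Set.univ) {v θ T : ℝ}
    (h : ∀ t, 0 < t → t * θ < 1 → tiltEntropy Z μ t ≤ t ^ 2 * (v / (1 - t * θ) ^ 2))
    (hθ : 0 ≤ θ) (hT : 0 < T) (hTθ : T * θ < 1) :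
    cgf Z μ T ≤ T * (μ[Z] + T * v / (1 - T * θ)) := by
  have hTt {t : ℝ} (ht : t ≤ T) : t * θ < 1 := (mul_le_mul_of_nonneg_right ht hθ).trans_lt hTθ
  have hderiv (t : ℝ) (ht : t ≤ T) :
      HasDerivAt (fun t => t * v / (1 - t * θ)) (v / (1 - t * θ) ^ 2) t := by
    have hne : 1 - t * θ ≠ 0 := (sub_pos.2 (hTt ht)).ne'
    refine (((hasDerivAt_id' t).mul_const v).div
      (((hasDerivAt_id' t).mul_const θ).const_sub 1) hne).congr_deriv ?_
    ring
  have hherbst := le_mul_deriv_zero_add hT cgf_zero (by simp)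
    (fun t _ => differentiableAt_cgf hZ t) (fun t ht => (hderiv t ht.2).differentiableAt)
    fun t ht => by
      rw [(hderiv t ht.2.le).deriv]
      exact h t ht.1 (hTt ht.2.le)
  simpa [deriv_cgf_zero (X := Z) (μ := μ) (by simp [hZ])] using hherbst

theorem measureReal_ge_le_exp_neg_of_cgf_le (hZ : integrableExpSet Z μ = Set.univ) {v θ β x : ℝ}
    (h : ∀ t, 0 < t → t * θ < 1 → cgf Z μ t ≤ t * (μ[Z] + t * v / (1 - t * θ))) (hv : 0 ≤ v)
    (hβ : 0 < β) (hθβ : θ < β) (hx : 0 < x) :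
    μ.real {ω | μ[Z] + (2 * √(v * x) + β * x) ≤ Z ω} ≤ Real.exp (-x) := by
  -- Chernoff's bound is used at `t = (β + √(v / x))⁻¹`.
  obtain ⟨y, hy, rfl⟩ : ∃ y, 0 ≤ y ∧ v = x * y ^ 2 :=
    ⟨√(v / x), by positivity, by rw [Real.sq_sqrt (by positivity)]; field_simp⟩
  rw [show x * y ^ 2 * x = (x * y) ^ 2 by ring, Real.sqrt_sq (by positivity)]
  have hβy : 0 < β + y := by positivity
  have htθ : (β + y)⁻¹ * θ < 1 := by
    rw [inv_mul_lt_one₀ hβy]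
    linarith
  have hcgf := h (β + y)⁻¹ (by positivity) htθ
  have hvar : (β + y)⁻¹ * (x * y ^ 2) / (1 - (β + y)⁻¹ * θ) ≤ x * y := by
    rw [div_le_iff₀ (sub_pos.2 htθ), inv_mul_le_iff₀ hβy]
    have : (β + y) * (x * y * (1 - (β + y)⁻¹ * θ)) = x * y * (β - θ + y) := by field_simp; ring
    nlinarith [mul_nonneg hx.le hy]
  refine (measure_ge_le_exp_cgf _ (inv_nonneg.2 hβy.le)
    (show (β + y)⁻¹ ∈ integrableExpSet Z μ by simp [hZ])).trans (Real.exp_le_exp.2 ?_)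
  have hxt : (β + y)⁻¹ * (x * y + β * x) = x := by field_simp; ring
  nlinarith [mul_le_mul_of_nonneg_left hvar (inv_nonneg.2 hβy.le)]

theorem measureReal_ge_le_exp_neg_of_selfBounding (hZ : integrableExpSet Z μ = Set.univ)
    (hQ : integrableExpSet Q μ = Set.univ) {a b B θ β v x : ℝ} (ha : 0 < a) (hb : 0 ≤ b)
    (hθ : 0 < θ) (haB : a * B = θ ^ 2)
    (hself : ∀ t, 0 < t → tiltEntropy Q μ t ≤ t ^ 2 * (B * ∫ ω, Q ω ∂(μ.tilted (t * Q ·))))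
    (hQZ : ∀ t, Integrable Q (μ.tilted (t * Z ·)))
    (hent : ∀ t, 0 < t →
      tiltEntropy Z μ t ≤ t ^ 2 * (a * ∫ ω, Q ω ∂(μ.tilted (t * Z ·)) + b))
    (hv₀ : 0 ≤ v) (hv : a * μ[Q] + b ≤ v) (hθβ : θ < β) (hx : 0 < x) :
    μ.real {ω | μ[Z] + (2 * √(v * x) + β * x) ≤ Z ω} ≤ Real.exp (-x) := by
  refine measureReal_ge_le_exp_neg_of_cgf_le hZ (fun t ht htθ => cgf_le_of_tiltEntropy_le hZ
    (fun t ht htθ => ?_) hθ.le ht htθ) hv₀ (hθ.trans hθβ) hθβ hx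
  refine (tiltEntropy_le_of_selfBounding hZ hQ ha hθ haB hself ht htθ (hQZ t) hb
    (hent t ht)).trans ?_
  gcongr

end Cgf

section Entropy

variable {ι : Type*} {s : Finset ι}

/-- The entropy `E[f log f] - E[f] log E[f]` of `f` under the uniform law on `s`. -/
def finEnt (s : Finset ι) (f : ι → ℝ) : ℝ :=
  𝔼 i ∈ s, f i * Real.log (f i) - (𝔼 i ∈ s, f i) * Real.log (𝔼 i ∈ s, f i)

/-- The symmetrized divergence `(x - y) (log x - log y)`, whose average over the pairs of neighbours
is the Dirichlet form of `f` and `log f`. -/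
def symDiv (x y : ℝ) : ℝ := (x - y) * (Real.log x - Real.log y)

theorem symDiv_self (x : ℝ) : symDiv x x = 0 := by simp [symDiv]

theorem symDiv_comm (x y : ℝ) : symDiv x y = symDiv y x := by unfold symDiv; ring

theorem symDiv_nonneg {x y : ℝ} (hx : 0 < x) (hy : 0 < y) : 0 ≤ symDiv x y := by
  rcases le_total x y with h | h
  · exact mul_nonneg_of_nonpos_of_nonpos (sub_nonpos.2 h) (sub_nonpos.2 (Real.log_le_log hx h))
  · exact mul_nonneg (sub_nonneg.2 h) (sub_nonneg.2 (Real.log_le_log hy h))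

theorem expect_mul_log_expect_sub_log_expect_le (hs : s.Nonempty) {x y : ι → ℝ}
    (hx : ∀ i ∈ s, 0 < x i) (hy : ∀ i ∈ s, 0 < y i) :
    (𝔼 i ∈ s, x i) * (Real.log (𝔼 i ∈ s, x i) - Real.log (𝔼 i ∈ s, y i)) ≤
      𝔼 i ∈ s, x i * (Real.log (x i) - Real.log (y i)) := by
  have hX : 0 < 𝔼 i ∈ s, x i := expect_pos hx hs
  have hY : 0 < 𝔼 i ∈ s, y i := expect_pos hy hs
  set X := 𝔼 i ∈ s, x i with hXd
  set Y := 𝔼 i ∈ s, y i with hYd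
  have htangent (i : ι) (hi : i ∈ s) : x i * (Real.log X - Real.log Y) + (x i - y i * (X / Y)) ≤
      x i * (Real.log (x i) - Real.log (y i)) := by
    have hxi := hx i hi
    have hyi := hy i hi
    have hlog := Real.log_le_sub_one_of_pos (show 0 < y i * X / (x i * Y) by positivity)
    rw [Real.log_div (by positivity) (by positivity), Real.log_mul hyi.ne' hX.ne',
      Real.log_mul hxi.ne' hY.ne'] at hlog
    have hmul : x i * (y i * X / (x i * Y) - 1) = y i * (X / Y) - x i := by field_simp
    linarith [mul_le_mul_of_nonneg_left hlog hxi.le]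
  refine le_trans (le_of_eq ?_) (expect_le_expect htangent)
  rw [expect_add_distrib, expect_sub_distrib, ← expect_mul, ← expect_mul, ← hXd, ← hYd,
    mul_div_cancel₀ _ hY.ne', sub_self, add_zero]

theorem symDiv_expect_le (hs : s.Nonempty) {x y : ι → ℝ} (hx : ∀ i ∈ s, 0 < x i)
    (hy : ∀ i ∈ s, 0 < y i) :
    symDiv (𝔼 i ∈ s, x i) (𝔼 i ∈ s, y i) ≤ 𝔼 i ∈ s, symDiv (x i) (y i) := by
  have hsplit (a b : ℝ) : symDiv a b =
      a * (Real.log a - Real.log b) + b * (Real.log b - Real.log a) := by unfold symDiv; ring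
  simp only [hsplit, expect_add_distrib]
  exact add_le_add (expect_mul_log_expect_sub_log_expect_le hs hx hy)
    (expect_mul_log_expect_sub_log_expect_le hs hy hx)

theorem finEnt_le_expect_symDiv (hs : s.Nonempty) {f : ι → ℝ} (hf : ∀ i ∈ s, 0 < f i) :
    finEnt s f ≤ (1 / 2) * 𝔼 a ∈ s, 𝔼 b ∈ s, symDiv (f a) (f b) := by
  have hjensen : (𝔼 i ∈ s, f i) * 𝔼 i ∈ s, Real.log (f i) ≤
      (𝔼 i ∈ s, f i) * Real.log (𝔼 i ∈ s, f i) := by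
    have hlog := expect_mul_log_expect_sub_log_expect_le hs (x := fun _ => 1)
      (fun _ _ => one_pos) hf
    simp only [expect_const hs, Real.log_one, one_mul, zero_sub, expect_neg_distrib,
      neg_le_neg_iff] at hlog
    exact mul_le_mul_of_nonneg_left hlog (expect_pos hf hs).le
  have hexpand (a b : ι) : symDiv (f a) (f b) = f a * Real.log (f a) + f b * Real.log (f b)
      - f a * Real.log (f b) - Real.log (f a) * f b := by unfold symDiv; ring
  simp only [finEnt, hexpand, expect_sub_distrib, expect_add_distrib, expect_const hs,
    ← mul_expect, ← expect_mul]
  linarith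

end Entropy

section Slice

variable {α : Type*} [DecidableEq α] {A S : Finset α} {p q : α}

theorem mem_swap_smul_finset {x : α} : x ∈ Equiv.swap p q • S ↔ Equiv.swap p q x ∈ S := by
  rw [← Equiv.Perm.smul_def, ← inv_smul_mem_iff, Equiv.swap_inv]

theorem swap_smul_of_mem (hp : p ∈ S) (hq : q ∈ S) : Equiv.swap p q • S = S := by
  ext x
  rw [mem_swap_smul_finset]
  grind

theorem swap_smul_subset_iff {T : Finset α} (hp : p ∈ A) (hq : q ∈ A) :
    Equiv.swap p q • T ⊆ A ↔ T ⊆ A := by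
  rw [← smul_finset_subset_smul_finset_iff (a := Equiv.swap p q) (s := T), swap_smul_of_mem hp hq]

theorem swap_smul_insert_of_ne {a : α} (hp : a ≠ p) (hq : a ≠ q) (S : Finset α) :
    Equiv.swap p q • insert a S = insert a (Equiv.swap p q • S) := by
  rw [smul_finset_insert, Equiv.Perm.smul_def, Equiv.swap_apply_of_ne_of_ne hp hq]

theorem sum_swap_smul (hp : p ∈ S) (hq : q ∉ S) (h : α → ℝ) :
    ∑ x ∈ Equiv.swap p q • S, h x = ∑ x ∈ S, h x - h p + h q := by
  have hS : Equiv.swap p q • S = insert q (S.erase p) := by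
    ext x
    rw [mem_swap_smul_finset]
    grind
  rw [hS, sum_insert (by simp [hq]), ← sum_erase_eq_sub hp, add_comm]

theorem sum_powersetCard_succ (A : Finset α) (k : ℕ) (F : α → Finset α → ℝ) :
    ∑ S ∈ A.powersetCard (k + 1), ∑ a ∈ S, F a S =
      ∑ a ∈ A, ∑ T ∈ (A.erase a).powersetCard k, F a (insert a T) := by
  rw [sum_sigma', sum_sigma']
  refine sum_bij' (fun x _ => ⟨x.2, x.1.erase x.2⟩) (fun y _ => ⟨insert y.1 y.2, y.1⟩)
    ?_ ?_ ?_ ?_ ?_ <;> simp only [mem_sigma, mem_powersetCard] <;>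
    grind [insert_erase, erase_insert]

theorem expect_powersetCard_succ (A : Finset α) (k : ℕ) (F : α → Finset α → ℝ) :
    𝔼 S ∈ A.powersetCard (k + 1), 𝔼 a ∈ S, F a S =
      𝔼 a ∈ A, 𝔼 T ∈ (A.erase a).powersetCard k, F a (insert a T) := by
  rcases A.eq_empty_or_nonempty with rfl | hA
  · rw [powersetCard_eq_empty.2 (by simp), expect_empty, expect_empty]
  have hinner (S : Finset α) (hS : S ∈ A.powersetCard (k + 1)) :
      𝔼 a ∈ S, F a S = (∑ a ∈ S, F a S) / (k + 1 : ℕ) := by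
    rw [expect_eq_sum_div_card, (mem_powersetCard.1 hS).2]
  have houter (a : α) (ha : a ∈ A) : 𝔼 T ∈ (A.erase a).powersetCard k, F a (insert a T) =
      (∑ T ∈ (A.erase a).powersetCard k, F a (insert a T)) / (#A - 1).choose k := by
    rw [expect_eq_sum_div_card, card_powersetCard, card_erase_of_mem ha]
  have hchoose : (#A : ℝ) * (#A - 1).choose k = (#A).choose (k + 1) * (k + 1 : ℕ) := by
    obtain ⟨n, hn⟩ := Nat.exists_eq_add_of_lt hA.card_pos
    have := Nat.add_one_mul_choose_eq n k
    rw [hn, zero_add, Nat.add_sub_cancel]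
    exact_mod_cast this
  rw [expect_congr rfl hinner, expect_congr rfl houter, expect_eq_sum_div_card,
    expect_eq_sum_div_card, ← sum_div, ← sum_div, div_div, div_div, sum_powersetCard_succ,
    card_powersetCard, mul_comm _ (#A : ℝ), hchoose, mul_comm (_ : ℝ) (k + 1 : ℕ)]

theorem expect_powersetCard_succ_insert (A : Finset α) (k : ℕ) (f : Finset α → ℝ) :
    𝔼 S ∈ A.powersetCard (k + 1), f S =
      𝔼 a ∈ A, 𝔼 T ∈ (A.erase a).powersetCard k, f (insert a T) := by
  rw [← expect_powersetCard_succ A k fun _ S => f S]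
  refine expect_congr rfl fun S hS => (expect_const (card_pos.1 ?_) _).symm
  exact (mem_powersetCard.1 hS).2 ▸ k.succ_pos

theorem finEnt_powersetCard_succ (A : Finset α) (k : ℕ) (f : Finset α → ℝ) :
    finEnt (A.powersetCard (k + 1)) f =
      𝔼 a ∈ A, finEnt ((A.erase a).powersetCard k) (fun T => f (insert a T)) +
        finEnt A (fun a => 𝔼 T ∈ (A.erase a).powersetCard k, f (insert a T)) := by
  simp only [finEnt, expect_powersetCard_succ_insert A k, expect_sub_distrib]
  ring

theorem expect_insert_eq_expect_swap_smul {a b : α} {k : ℕ} (ha : a ∈ A) (hb : b ∈ A)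
    (f : Finset α → ℝ) :
    𝔼 T ∈ (A.erase b).powersetCard k, f (insert b T) =
      𝔼 T ∈ (A.erase a).powersetCard k, f (Equiv.swap a b • insert a T) := by
  have hA : A.erase b = Equiv.swap a b • A.erase a := by
    ext x
    rw [mem_swap_smul_finset]
    grind
  symm
  refine expect_equiv (MulAction.toPerm (Equiv.swap a b)) (fun T => ?_) fun T _ => ?_
  · simp [mem_powersetCard, hA, smul_finset_subset_smul_finset_iff, card_smul_finset]
  · rw [smul_finset_insert, Equiv.Perm.smul_def, Equiv.swap_apply_left, MulAction.toPerm_apply]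

theorem expect_le_expect_sdiff {S : Finset α} {g : α → ℝ} (hS : S ⊆ A) (hg₀ : ∀ a ∈ S, g a = 0)
    (hg : ∀ a ∈ A \ S, 0 ≤ g a) : 𝔼 a ∈ A, g a ≤ 𝔼 a ∈ A \ S, g a := by
  rw [expect_eq_sum_div_card, expect_eq_sum_div_card, ← sum_sdiff hS, sum_eq_zero hg₀, add_zero]
  rcases (A \ S).eq_empty_or_nonempty with h | h
  · simp [h]
  · have := h.card_pos
    exact div_le_div_of_nonneg_left (sum_nonneg hg) (by exact_mod_cast this)
      (by exact_mod_cast card_le_card sdiff_subset)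

/-- The mean of the total of `F S S'` over the jumps `S ⟶ S'` of the exchange dynamics on the
`k`-element subsets of `A`, in which every point of `S` is exchanged at rate one with a uniformly
chosen point of `A \ S`. For `F S S' = symDiv (f S) (f S')` it is the Dirichlet form that controls
the entropy of `f`. -/
def exchangeForm (A : Finset α) (k : ℕ) (F : Finset α → Finset α → ℝ) : ℝ :=
  𝔼 S ∈ A.powersetCard k, ∑ p ∈ S, 𝔼 q ∈ A \ S, F S (Equiv.swap p q • S)

theorem exchangeForm_eq_sum_div (A : Finset α) (k : ℕ) (F : Finset α → Finset α → ℝ) :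
    exchangeForm A k F = (∑ S ∈ A.powersetCard k, ∑ p ∈ S, ∑ q ∈ A \ S,
      F S (Equiv.swap p q • S)) / (#A - k : ℕ) / #(A.powersetCard k) := by
  rw [exchangeForm, expect_eq_sum_div_card]
  refine congrArg (· / (#(A.powersetCard k) : ℝ)) ?_
  rw [sum_div]
  refine sum_congr rfl fun S hS => ?_
  obtain ⟨hSA, hSk⟩ := mem_powersetCard.1 hS
  simp only [expect_eq_sum_div_card, sum_div, card_sdiff_of_subset hSA, hSk]

theorem exchangeForm_symm (A : Finset α) (k : ℕ) (F : Finset α → Finset α → ℝ) :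
    exchangeForm A k (fun S S' => F S' S) = exchangeForm A k F := by
  simp only [exchangeForm_eq_sum_div, ← sum_product']
  congr 2
  rw [sum_sigma', sum_sigma']
  have hmem (x : (_ : Finset α) × (α × α))
      (hx : x ∈ (A.powersetCard k).sigma fun S => S ×ˢ (A \ S)) :
      ⟨Equiv.swap x.2.1 x.2.2 • x.1, (x.2.2, x.2.1)⟩ ∈
        (A.powersetCard k).sigma fun S => S ×ˢ (A \ S) := by
    obtain ⟨S, p, q⟩ := x
    simp only [mem_sigma, mem_powersetCard, mem_product, mem_sdiff, mem_swap_smul_finset,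
      card_smul_finset, Equiv.swap_apply_left, Equiv.swap_apply_right] at hx ⊢
    obtain ⟨⟨hSA, hSk⟩, hp, hqA, hqS⟩ := hx
    exact ⟨⟨(swap_smul_subset_iff (hSA hp) hqA).2 hSA, hSk⟩, hp, hSA hp, hqS⟩
  refine sum_bij' (fun x _ => ⟨Equiv.swap x.2.1 x.2.2 • x.1, (x.2.2, x.2.1)⟩)
    (fun x _ => ⟨Equiv.swap x.2.1 x.2.2 • x.1, (x.2.2, x.2.1)⟩) hmem hmem ?_ ?_ ?_
  all_goals
    rintro ⟨S, p, q⟩ _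
    simp [Equiv.swap_comm q p]

theorem expect_exchangeForm_erase (A : Finset α) (k : ℕ) (F : Finset α → Finset α → ℝ) :
    𝔼 a ∈ A, exchangeForm (A.erase a) k (fun T T' => F (insert a T) (insert a T')) =
      k / (k + 1) * exchangeForm A (k + 1) F := by
  have hinsert (a : α) (T : Finset α) (hT : T ∈ (A.erase a).powersetCard k) :
      ∑ p ∈ T, 𝔼 q ∈ A.erase a \ T, F (insert a T) (insert a (Equiv.swap p q • T)) =
        ∑ p ∈ (insert a T).erase a, 𝔼 q ∈ A \ insert a T,
          F (insert a T) (Equiv.swap p q • insert a T) := by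
    have haT : a ∉ T := fun h => notMem_erase a A ((mem_powersetCard.1 hT).1 h)
    rw [erase_insert haT, show A.erase a \ T = A \ insert a T by grind]
    refine sum_congr rfl fun p hp => expect_congr rfl fun q hq => ?_
    rw [swap_smul_insert_of_ne (by grind) (by grind)]
  have hcount (S : Finset α) (hS : S ∈ A.powersetCard (k + 1)) (g : α → ℝ) :
      𝔼 a ∈ S, ∑ p ∈ S.erase a, g p = k / (k + 1) * ∑ p ∈ S, g p := by
    have hSk := (mem_powersetCard.1 hS).2
    rw [expect_congr rfl fun a ha => sum_erase_eq_sub ha, expect_sub_distrib,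
      expect_const (card_pos.1 (hSk ▸ k.succ_pos)), expect_eq_sum_div_card, hSk]
    push_cast
    field_simp
    ring
  simp only [exchangeForm]
  rw [expect_congr rfl fun a _ => expect_congr rfl (hinsert a),
    ← expect_powersetCard_succ A k fun a S => ∑ p ∈ S.erase a, 𝔼 q ∈ A \ S,
      F S (Equiv.swap p q • S), expect_congr rfl fun S hS => hcount S hS _, mul_expect]

theorem expect_expect_swap_smul_le {F : Finset α → Finset α → ℝ} (hF : ∀ S T, 0 ≤ F S T)
    (hF₀ : ∀ S, F S S = 0) (A : Finset α) (k : ℕ) :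
    𝔼 a ∈ A, 𝔼 b ∈ A, 𝔼 T ∈ (A.erase a).powersetCard k,
      F (insert a T) (Equiv.swap a b • insert a T) ≤ 1 / (k + 1) * exchangeForm A (k + 1) F := by
  have hrate (S : Finset α) (hS : S ∈ A.powersetCard (k + 1)) :
      𝔼 a ∈ S, 𝔼 b ∈ A, F S (Equiv.swap a b • S) ≤
        1 / (k + 1) * ∑ a ∈ S, 𝔼 b ∈ A \ S, F S (Equiv.swap a b • S) := by
    obtain ⟨hSA, hSk⟩ := mem_powersetCard.1 hS
    refine (expect_le_expect fun a ha => expect_le_expect_sdiff hSA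
      (fun b hb => by rw [swap_smul_of_mem ha hb, hF₀]) fun b _ => hF _ _).trans_eq ?_
    rw [expect_eq_sum_div_card, hSk]
    push_cast
    ring
  simp only [expect_comm (s := A) (t := powersetCard _ _)]
  rw [← expect_powersetCard_succ A k fun a S => 𝔼 b ∈ A, F S (Equiv.swap a b • S), exchangeForm,
    mul_expect]
  exact expect_le_expect hrate

theorem finEnt_expect_insert_le (A : Finset α) {k : ℕ} (hk : k < #A) {f : Finset α → ℝ}
    (hf : ∀ S, 0 < f S) :
    finEnt A (fun a => 𝔼 T ∈ (A.erase a).powersetCard k, f (insert a T)) ≤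
      1 / 2 * (1 / (k + 1) * exchangeForm A (k + 1) fun S S' => symDiv (f S) (f S')) := by
  have hne (a : α) (ha : a ∈ A) : ((A.erase a).powersetCard k).Nonempty :=
    powersetCard_nonempty.2 (by rw [card_erase_of_mem ha]; omega)
  refine (finEnt_le_expect_symDiv (card_pos.1 (by omega)) fun a ha =>
    expect_pos (fun _ _ => hf _) (hne a ha)).trans ?_
  refine mul_le_mul_of_nonneg_left (le_trans ?_ (expect_expect_swap_smul_le
    (fun S T => symDiv_nonneg (hf S) (hf T)) (fun S => symDiv_self _) A k)) (by norm_num)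
  refine expect_le_expect fun a ha => expect_le_expect fun b hb => ?_
  rw [expect_insert_eq_expect_swap_smul ha hb]
  exact symDiv_expect_le (hne a ha) (fun _ _ => hf _) fun _ _ => hf _

theorem finEnt_powersetCard_le_exchangeForm (A : Finset α) (k : ℕ) {f : Finset α → ℝ}
    (hf : ∀ S, 0 < f S) :
    finEnt (A.powersetCard k) f ≤
      1 / 2 * exchangeForm A k fun S S' => symDiv (f S) (f S') := by
  induction k generalizing A f with
  | zero => simp [finEnt, exchangeForm]
  | succ k ih =>
    rcases le_or_gt #A k with hk | hk
    · simp [powersetCard_eq_empty.2 (Nat.lt_succ_of_le hk), finEnt, exchangeForm]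
    have hfirst : 𝔼 a ∈ A, finEnt ((A.erase a).powersetCard k) (fun T => f (insert a T)) ≤
        1 / 2 * (k / (k + 1) * exchangeForm A (k + 1) fun S S' => symDiv (f S) (f S')) := by
      rw [← expect_exchangeForm_erase, mul_expect]
      exact expect_le_expect fun a _ => ih (A.erase a) fun _ => hf _
    -- The chain rule for a uniform element of `S` splits the constant as
    -- `k / (k + 1) + 1 / (k + 1)`.
    rw [finEnt_powersetCard_succ]
    refine (add_le_add hfirst (finEnt_expect_insert_le A hk hf)).trans_eq ?_
    field_simp

theorem symDiv_exp_le (a b : ℝ) :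
    symDiv (Real.exp a) (Real.exp b) ≤ Real.exp a * (a - b)⁺ ^ 2 + Real.exp b * (b - a)⁺ ^ 2 := by
  wlog h : b ≤ a generalizing a b
  · rw [symDiv_comm, add_comm]
    exact this b a (le_of_not_ge h)
  rw [posPart_of_nonneg (sub_nonneg.2 h), posPart_of_nonpos (sub_nonpos.2 h), zero_pow two_ne_zero,
    mul_zero, add_zero, symDiv, Real.log_exp, Real.log_exp, sq, ← mul_assoc]
  refine mul_le_mul_of_nonneg_right ?_ (sub_nonneg.2 h)
  have hexp : Real.exp b = Real.exp a * Real.exp (b - a) := by rw [← Real.exp_add]; ring_nf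
  nlinarith [Real.add_one_le_exp (b - a), Real.exp_pos a]

end Slice

theorem bddAbove_range_expect {α κ : Type*} {f : κ → α → ℝ} {b : ℝ} (hb : ∀ j a, f j a ≤ b)
    (T : Finset α) : BddAbove (Set.range fun j => 𝔼 a ∈ T, f j a) := by
  refine ⟨𝔼 _a ∈ T, b, ?_⟩
  rintro _ ⟨j, rfl⟩
  exact expect_le_expect fun a _ => hb j a

section ExchangeVar

variable {α : Type*} [DecidableEq α] [Fintype α]

/-- The total squared decrease of `Z` under exchanges of an element of `S` with a uniform element of
`Sᶜ`: the analogue of the variance proxy `∑ i, (Z - Z⁽ⁱ⁾)⁺ ^ 2` of the entropy method for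
independent coordinates. -/
def exchangeVar (Z : Finset α → ℝ) (S : Finset α) : ℝ :=
  ∑ p ∈ S, 𝔼 q ∈ Sᶜ, (Z S - Z (Equiv.swap p q • S))⁺ ^ 2

theorem finEnt_exp_mul_le (Z : Finset α → ℝ) (k : ℕ) {t : ℝ} (ht : 0 ≤ t) :
    finEnt (univ.powersetCard k) (fun S => Real.exp (t * Z S)) ≤
      t ^ 2 * 𝔼 S ∈ univ.powersetCard k, Real.exp (t * Z S) * exchangeVar Z S := by
  set F : Finset α → Finset α → ℝ := fun S S' => Real.exp (t * Z S) * (t * Z S - t * Z S')⁺ ^ 2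
  have hF (S S' : Finset α) : F S S' = t ^ 2 * (Real.exp (t * Z S) * (Z S - Z S')⁺ ^ 2) := by
    have hpos : (t * Z S - t * Z S')⁺ = t * (Z S - Z S')⁺ := by
      rw [← mul_sub, posPart_def, posPart_def]
      simpa using (mul_max_of_nonneg (Z S - Z S') 0 ht).symm
    simp only [F, hpos]
    ring
  have hform : exchangeForm univ k F =
      t ^ 2 * 𝔼 S ∈ univ.powersetCard k, Real.exp (t * Z S) * exchangeVar Z S := by
    simp only [exchangeForm, exchangeVar, hF, mul_sum, mul_expect, compl_eq_univ_sdiff]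
  calc
    _ ≤ 1 / 2 * exchangeForm univ k fun S S' => F S S' + F S' S := by
      refine (finEnt_powersetCard_le_exchangeForm univ k fun _ => Real.exp_pos _).trans ?_
      exact mul_le_mul_of_nonneg_left (expect_le_expect fun S _ => sum_le_sum fun p _ =>
        expect_le_expect fun q _ => symDiv_exp_le _ _) (by norm_num)
    _ = 1 / 2 * (exchangeForm univ k F + exchangeForm univ k fun S S' => F S' S) := by
      simp only [exchangeForm, expect_add_distrib, sum_add_distrib]
    _ = _ := by rw [exchangeForm_symm univ k F, hform]; ring

theorem exchangeVar_iSup_le {κ : Type*} [Nonempty κ] {f : κ → Finset α → ℝ} {S : Finset α} {M : ℝ}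
    (hbdd : ∀ T, BddAbove (Set.range fun j => f j T)) (h : ∀ j, exchangeVar (f j) S ≤ M) :
    exchangeVar (fun T => ⨆ j, f j T) S ≤ M := by
  set F : Finset α → ℝ := fun T => ⨆ j, f j T
  have hclosed : IsClosed {y | ∑ p ∈ S, 𝔼 q ∈ Sᶜ, (y - F (Equiv.swap p q • S))⁺ ^ 2 ≤ M} := by
    simp only [expect_eq_sum_div_card]
    exact isClosed_le (by fun_prop) continuous_const
  refine hclosed.closure_subset_iff.2 ?_
    (csSup_mem_closure (Set.range_nonempty fun j => f j S) (hbdd S))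
  rintro _ ⟨j, rfl⟩
  refine le_trans (sum_le_sum fun p _ => expect_le_expect fun q _ => ?_) (h j)
  refine pow_le_pow_left₀ (posPart_nonneg _) (posPart_mono (sub_le_sub_left ?_ _)) 2
  exact le_ciSup (hbdd _) j

theorem exchangeVar_expect (f : α → ℝ) (S : Finset α) :
    exchangeVar (fun T => 𝔼 a ∈ T, f a) S =
      1 / #S * 𝔼 p ∈ S, 𝔼 q ∈ Sᶜ, (f p - f q)⁺ ^ 2 := by
  rw [expect_eq_sum_div_card S, sum_div, mul_sum]
  refine sum_congr rfl fun p hp => ?_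
  rw [← mul_div_assoc, mul_div_right_comm, mul_expect]
  refine expect_congr rfl fun q hq => ?_
  have hdiff : 𝔼 a ∈ S, f a - 𝔼 a ∈ Equiv.swap p q • S, f a = 1 / #S * (f p - f q) := by
    rw [expect_eq_sum_div_card, expect_eq_sum_div_card, card_smul_finset,
      sum_swap_smul hp (mem_compl.1 hq)]
    ring
  have hpos : (1 / (#S : ℝ) * (f p - f q))⁺ = 1 / #S * (f p - f q)⁺ := by
    rw [posPart_def, posPart_def]
    simpa using (mul_max_of_nonneg (f p - f q) 0 (show 0 ≤ 1 / (#S : ℝ) by positivity)).symm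
  rw [hdiff, hpos]
  ring

theorem expect_compl_le {f : α → ℝ} (hf : ∀ a, 0 ≤ f a) {S : Finset α}
    (hS : 2 * #S ≤ Fintype.card α) :
    𝔼 a ∈ Sᶜ, f a ≤ 2 * 𝔼 a, f a := by
  have hsum : 0 ≤ ∑ a ∈ Sᶜ, f a := sum_nonneg fun a _ => hf a
  have hle : ∑ a ∈ Sᶜ, f a ≤ ∑ a, f a :=
    sum_le_sum_of_subset_of_nonneg (subset_univ _) fun a _ _ => hf a
  have hcard : (Fintype.card α : ℝ) ≤ 2 * #Sᶜ := by
    rw [card_compl]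
    exact_mod_cast (by omega : Fintype.card α ≤ 2 * (Fintype.card α - #S))
  rw [expect_eq_sum_div_card, expect_eq_sum_div_card, card_univ]
  rcases (Nat.cast_nonneg (α := ℝ) #Sᶜ).eq_or_lt with h | h
  · rw [← h, div_zero]
    exact mul_nonneg two_pos.le (div_nonneg (hsum.trans hle) (Nat.cast_nonneg _))
  rcases (Nat.cast_nonneg (α := ℝ) (Fintype.card α)).eq_or_lt with h' | h'
  · exact absurd (Nat.cast_le (α := ℝ).2 (card_le_univ Sᶜ)) (by linarith)
  rw [← mul_div_assoc, div_le_div_iff₀ h h']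
  nlinarith

theorem exchangeVar_expect_le_expect_sq (f : α → ℝ) {S : Finset α}
    (hS : 2 * #S ≤ Fintype.card α) :
    exchangeVar (fun T => 𝔼 a ∈ T, f a) S ≤
      2 / #S * 𝔼 a ∈ S, f a ^ 2 + 4 / #S * 𝔼 a, f a ^ 2 := by
  rcases S.eq_empty_or_nonempty with rfl | hne
  · simp [exchangeVar]
  have hcompl : (Sᶜ).Nonempty := by
    rw [← card_pos, card_compl]
    have := hne.card_pos
    omega
  have hsq (x y : ℝ) : (x - y)⁺ ^ 2 ≤ 2 * x ^ 2 + 2 * y ^ 2 := by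
    rcases le_total x y with h | h
    · rw [posPart_of_nonpos (sub_nonpos.2 h), zero_pow two_ne_zero]
      positivity
    · rw [posPart_of_nonneg (sub_nonneg.2 h)]
      nlinarith [sq_nonneg (x + y)]
  rw [exchangeVar_expect]
  calc
    _ ≤ 1 / (#S : ℝ) * 𝔼 p ∈ S, 𝔼 q ∈ Sᶜ, (2 * f p ^ 2 + 2 * f q ^ 2) := by
      gcongr
      exact hsq _ _
    _ = 1 / #S * (2 * 𝔼 p ∈ S, f p ^ 2 + 2 * 𝔼 q ∈ Sᶜ, f q ^ 2) := by
      simp only [expect_add_distrib, expect_const hne, expect_const hcompl, ← mul_expect]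
    _ ≤ 1 / #S * (2 * 𝔼 p ∈ S, f p ^ 2 + 2 * (2 * 𝔼 a, f a ^ 2)) := by
      gcongr
      exact expect_compl_le (fun a => sq_nonneg (f a)) hS
    _ = _ := by ring

theorem exchangeVar_expect_le_of_le {f : α → ℝ} (hf : ∀ a, 0 ≤ f a) {b : ℝ} (hb : ∀ a, f a ≤ b)
    (S : Finset α) :
    exchangeVar (fun T => 𝔼 a ∈ T, f a) S ≤ b / #S * 𝔼 a ∈ S, f a := by
  rw [exchangeVar_expect, ← mul_one_div b, mul_comm b, mul_assoc, mul_expect S f b]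
  refine mul_le_mul_of_nonneg_left (expect_le_expect fun p _ => ?_) (by positivity)
  have hbf : 0 ≤ b * f p := mul_nonneg ((hf p).trans (hb p)) (hf p)
  have hterm (q : α) : (f p - f q)⁺ ^ 2 ≤ b * f p := by
    have hpos : (f p - f q)⁺ ≤ f p :=
      (posPart_mono (sub_le_self (f p) (hf q))).trans_eq (posPart_of_nonneg (hf p))
    refine (pow_le_pow_left₀ (posPart_nonneg _) hpos 2).trans ?_
    rw [sq]
    exact mul_le_mul_of_nonneg_right (hb p) (hf p)
  rcases (Sᶜ).eq_empty_or_nonempty with h | h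
  · rwa [h, expect_empty]
  · exact expect_le h fun q _ => hterm q

section Supremum

variable {κ : Type*} [Nonempty κ] {h : κ → α → ℝ} {H₀ r : ℝ} {S : Finset α}

theorem exchangeVar_iSup_expect_le (hb : ∀ j a, |h j a| ≤ H₀) (hr : ∀ j, 𝔼 a, h j a ^ 2 ≤ r)
    (hS : 2 * #S ≤ Fintype.card α) :
    exchangeVar (fun T => ⨆ j, 𝔼 a ∈ T, h j a) S ≤
      2 / #S * (⨆ j, 𝔼 a ∈ S, h j a ^ 2) + 4 / #S * r := by
  refine exchangeVar_iSup_le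
    (bddAbove_range_expect fun j a => (le_abs_self _).trans (hb j a)) fun j => ?_
  refine (exchangeVar_expect_le_expect_sq (h j) hS).trans ?_
  have hsup : 𝔼 a ∈ S, h j a ^ 2 ≤ ⨆ j, 𝔼 a ∈ S, h j a ^ 2 :=
    le_ciSup (bddAbove_range_expect (fun j a => sq_le_sq.2 ((hb j a).trans (le_abs_self _))) S) j
  gcongr
  exact hr j

theorem exchangeVar_iSup_expect_sq_le (hb : ∀ j a, |h j a| ≤ H₀) (S : Finset α) :
    exchangeVar (fun T => ⨆ j, 𝔼 a ∈ T, h j a ^ 2) S ≤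
      H₀ ^ 2 / #S * ⨆ j, 𝔼 a ∈ S, h j a ^ 2 := by
  have hsq (j : κ) (a : α) : h j a ^ 2 ≤ H₀ ^ 2 := sq_le_sq.2 ((hb j a).trans (le_abs_self _))
  have hbdd := bddAbove_range_expect hsq
  refine exchangeVar_iSup_le hbdd fun j => ?_
  refine (exchangeVar_expect_le_of_le (fun a => sq_nonneg (h j a)) (hsq j) S).trans ?_
  gcongr
  exact le_ciSup (hbdd S) j

end Supremum

end ExchangeVar

section UniformSubset

variable {α Ω : Type*} [Fintype α] [MeasurableSpace Ω]

/-- The random set `S` is uniformly distributed on the `k`-element subsets of `α`, expressed through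
the expectations of the functions of `S`. -/
def IsUniformSubset (S : Ω → Finset α) (k : ℕ) (μ : Measure Ω) : Prop :=
  ∀ f : Finset α → ℝ, ∫ ω, f (S ω) ∂μ = 𝔼 T ∈ univ.powersetCard k, f T

variable {μ : Measure Ω} {S : Ω → Finset α} {k : ℕ}

theorem IsUniformSubset.compl [DecidableEq α] {l : ℕ} (hS : IsUniformSubset S k μ)
    (hkl : k + l = Fintype.card α) : IsUniformSubset (fun ω => (S ω)ᶜ) l μ := by
  intro f
  rw [hS fun T => f Tᶜ]
  refine expect_nbij' (·ᶜ) (·ᶜ) (fun T hT => ?_) (fun T hT => ?_) (fun _ _ => compl_compl _)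
    (fun _ _ => compl_compl _) fun _ _ => rfl
  all_goals
    rw [mem_powersetCard_univ] at hT ⊢
    rw [card_compl]
    omega

variable [Finite Ω] [MeasurableSingletonClass Ω]

theorem integrableExpSet_eq_univ_of_finite [IsFiniteMeasure μ] (Z : Ω → ℝ) :
    integrableExpSet Z μ = Set.univ :=
  Set.eq_univ_of_forall fun _ => Integrable.of_finite

variable [IsProbabilityMeasure μ]

theorem IsUniformSubset.tiltEntropy_eq_finEnt_div (hS : IsUniformSubset S k μ)
    (G : Finset α → ℝ) (t : ℝ) :
    tiltEntropy (fun ω => G (S ω)) μ t =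
      finEnt (univ.powersetCard k) (fun T => Real.exp (t * G T)) /
        mgf (fun ω => G (S ω)) μ t := by
  have hpos : 0 < mgf (fun ω => G (S ω)) μ t := mgf_pos .of_finite
  have hmgf : mgf (fun ω => G (S ω)) μ t = 𝔼 T ∈ univ.powersetCard k, Real.exp (t * G T) :=
    hS fun T => Real.exp (t * G T)
  have hderiv : t * deriv (cgf (fun ω => G (S ω)) μ) t =
      (𝔼 T ∈ univ.powersetCard k, Real.exp (t * G T) * (t * G T)) /
        mgf (fun ω => G (S ω)) μ t := by
    rw [deriv_cgf (by simp [integrableExpSet_eq_univ_of_finite]), ← mul_div_assoc,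
      ← integral_const_mul, ← hS fun T => Real.exp (t * G T) * (t * G T)]
    refine congrArg (· / _) (integral_congr_ae (.of_forall fun ω => ?_))
    ring
  simp only [tiltEntropy, hderiv, finEnt, Real.log_exp, cgf, sub_div]
  rw [← hmgf, mul_div_cancel_left₀ _ hpos.ne']

theorem IsUniformSubset.tiltEntropy_le [DecidableEq α] (hS : IsUniformSubset S k μ)
    {G V : Finset α → ℝ} (hV : ∀ T, #T = k → exchangeVar G T ≤ V T) {t : ℝ} (ht : 0 ≤ t) :
    tiltEntropy (fun ω => G (S ω)) μ t ≤ t ^ 2 * ∫ ω, V (S ω) ∂(μ.tilted fun ω => t * G (S ω)) := by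
  have hpos : 0 < mgf (fun ω => G (S ω)) μ t := mgf_pos .of_finite
  have htilt : ∫ ω, V (S ω) ∂(μ.tilted fun ω => t * G (S ω)) =
      (𝔼 T ∈ univ.powersetCard k, Real.exp (t * G T) * V T) / mgf (fun ω => G (S ω)) μ t := by
    rw [← hS fun T => Real.exp (t * G T) * V T, integral_tilted_mul_eq_mgf, ← integral_div]
    refine integral_congr_ae (.of_forall fun ω => ?_)
    simp only [smul_eq_mul]
    ring
  rw [hS.tiltEntropy_eq_finEnt_div, htilt, ← mul_div_assoc]
  refine div_le_div_of_nonneg_right ((finEnt_exp_mul_le G k ht).trans ?_) hpos.le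
  refine mul_le_mul_of_nonneg_left (expect_le_expect fun T hT => ?_) (sq_nonneg t)
  exact mul_le_mul_of_nonneg_left (hV T (mem_powersetCard.1 hT).2) (Real.exp_pos _).le

theorem expect_powersetCard_expect {k : ℕ} (hk : 0 < k) (hkα : k ≤ Fintype.card α) (f : α → ℝ) :
    𝔼 T ∈ univ.powersetCard k, 𝔼 a ∈ T, f a = 𝔼 a, f a := by
  classical
  obtain ⟨l, rfl⟩ := Nat.exists_eq_add_of_lt hk
  rw [zero_add, expect_powersetCard_succ univ l fun a _ => f a]
  refine expect_congr rfl fun a ha => expect_const (powersetCard_nonempty.2 ?_) _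
  rw [card_erase_of_mem ha, card_univ]
  omega

/-- The expected supremum `E[sup_j (E_S[f j] - E[f j])]` of the deviations of the averages over the
random set `S` from the averages over the whole population. -/
def subsetComplexity {κ : Type*} (S : Ω → Finset α) (μ : Measure Ω) (f : κ → α → ℝ) : ℝ :=
  ∫ ω, ⨆ j, (𝔼 a ∈ S ω, f j a - 𝔼 a, f j a) ∂μ

theorem two_mul_sqrt_le_iInf {R y : ℝ} (hR : 0 ≤ R) (hy : 0 ≤ y) :
    2 * √(R * y) ≤ ⨅ α : Set.Ioi (0 : ℝ), (R / (α : ℝ) + (α : ℝ) * y) := by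
  refine le_ciInf fun ⟨a, ha⟩ => ?_
  have ha : 0 < a := ha
  have hprod : R * y = R / a * (a * y) := by field_simp
  rw [hprod, Real.sqrt_mul (by positivity)]
  nlinarith [sq_nonneg (√(R / a) - √(a * y)), Real.sq_sqrt (show 0 ≤ R / a by positivity),
    Real.sq_sqrt (show 0 ≤ a * y by positivity)]

section Supremum

variable {κ : Type*} {f : κ → α → ℝ} {b c : ℝ}

theorem bddAbove_range_expect_sub (hb : ∀ j a, f j a ≤ b) (hc : ∀ j, c ≤ 𝔼 a, f j a)
    (T : Finset α) : BddAbove (Set.range fun j => 𝔼 a ∈ T, f j a - 𝔼 a, f j a) := by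
  obtain ⟨M, hM⟩ := bddAbove_range_expect hb T
  refine ⟨M - c, ?_⟩
  rintro _ ⟨j, rfl⟩
  exact sub_le_sub (hM ⟨j, rfl⟩) (hc j)

variable [Nonempty κ]

theorem IsUniformSubset.subsetComplexity_nonneg (hS : IsUniformSubset S k μ) (hk : 0 < k)
    (hkα : k ≤ Fintype.card α) (hb : ∀ j a, f j a ≤ b) (hc : ∀ j, c ≤ 𝔼 a, f j a) :
    0 ≤ subsetComplexity S μ f := by
  have j := Classical.arbitrary κ
  have hcentred : ∫ ω, (𝔼 a ∈ S ω, f j a - 𝔼 a, f j a) ∂μ = 0 := by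
    rw [integral_sub .of_finite .of_finite, hS fun T => 𝔼 a ∈ T, f j a,
      expect_powersetCard_expect hk hkα]
    simp
  rw [subsetComplexity, ← hcentred]
  exact integral_mono .of_finite .of_finite fun ω =>
    le_ciSup (bddAbove_range_expect_sub hb hc (S ω)) j

theorem integral_iSup_expect_le_subsetComplexity_add (hb : ∀ j a, f j a ≤ b)
    (hc : ∀ j, c ≤ 𝔼 a, f j a) {r : ℝ} (hr : ∀ j, 𝔼 a, f j a ≤ r) :
    ∫ ω, ⨆ j, 𝔼 a ∈ S ω, f j a ∂μ ≤ subsetComplexity S μ f + r := by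
  have hconst : ∫ _, r ∂μ = r := by simp
  rw [subsetComplexity, ← hconst, ← integral_add .of_finite .of_finite]
  refine integral_mono .of_finite .of_finite fun ω => ciSup_le fun j => ?_
  have := le_ciSup (bddAbove_range_expect_sub hb hc (S ω)) j
  linarith [hr j]

variable {h : κ → α → ℝ} {H₀ r x : ℝ}

theorem IsUniformSubset.measureReal_iSup_expect_ge_le (hS : IsUniformSubset S k μ) (hk : 0 < k)
    (hkα : 2 * k ≤ Fintype.card α) (hH₀ : 0 < H₀) (hb : ∀ j a, |h j a| ≤ H₀)
    (hr : ∀ j, 𝔼 a, h j a ^ 2 ≤ r) (hx : 0 < x) :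
    μ.real {ω | ∫ ω', ⨆ j, 𝔼 a ∈ S ω', h j a ∂μ +
      (2 * √(2 / k * (subsetComplexity S μ (fun j a => h j a ^ 2) + 3 * r) * x) +
        2 * H₀ / k * x) ≤ ⨆ j, 𝔼 a ∈ S ω, h j a} ≤ Real.exp (-x) := by
  classical
  have hsq (j : κ) (a : α) : h j a ^ 2 ≤ H₀ ^ 2 := sq_le_sq.2 ((hb j a).trans (le_abs_self _))
  have hsq₀ (j : κ) : 0 ≤ 𝔼 a, h j a ^ 2 := expect_nonneg fun a _ => sq_nonneg _
  have hr₀ : 0 ≤ r := (hsq₀ (Classical.arbitrary κ)).trans (hr _)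
  have hR := hS.subsetComplexity_nonneg hk (by omega) hsq hsq₀
  refine measureReal_ge_le_exp_neg_of_selfBounding (a := 2 / k) (b := 4 / k * r)
    (B := H₀ ^ 2 / k) (θ := √2 * H₀ / k) (Q := fun ω => ⨆ j, 𝔼 a ∈ S ω, h j a ^ 2)
    (integrableExpSet_eq_univ_of_finite _) (integrableExpSet_eq_univ_of_finite _)
    (by positivity) (by positivity) (by positivity) ?_ (fun t ht => ?_) (fun _ => .of_finite)
    (fun t ht => ?_) (by positivity) ?_ ?_ hx
  · rw [div_pow, mul_pow, Real.sq_sqrt zero_le_two]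
    ring
  · rw [← integral_const_mul]
    refine hS.tiltEntropy_le (G := fun T => ⨆ j, 𝔼 a ∈ T, h j a ^ 2)
      (V := fun T => H₀ ^ 2 / k * ⨆ j, 𝔼 a ∈ T, h j a ^ 2) (fun T hT => ?_) ht.le
    exact hT ▸ exchangeVar_iSup_expect_sq_le hb T
  · refine (hS.tiltEntropy_le (G := fun T => ⨆ j, 𝔼 a ∈ T, h j a)
      (V := fun T => 2 / k * (⨆ j, 𝔼 a ∈ T, h j a ^ 2) + 4 / k * r)
      (fun T hT => ?_) ht.le).trans_eq ?_
    · exact hT ▸ exchangeVar_iSup_expect_le hb hr (hT ▸ hkα)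
    · have := isProbabilityMeasure_tilted (μ := μ) (f := fun ω => t * ⨆ j, 𝔼 a ∈ S ω, h j a)
        .of_finite
      rw [integral_add .of_finite .of_finite, integral_const_mul, integral_const, probReal_univ,
        one_smul]
  · have hQ := integral_iSup_expect_le_subsetComplexity_add (S := S) (μ := μ) hsq hsq₀ hr
    calc
      _ ≤ 2 / k * (subsetComplexity S μ (fun j a => h j a ^ 2) + r) + 4 / k * r := by gcongr
      _ = _ := by ring
  · gcongr
    exact Real.sqrt_lt' two_pos |>.2 (by norm_num)

theorem IsUniformSubset.one_sub_exp_neg_le_measureReal_iSup_expect_sub_le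
    (hS : IsUniformSubset S k μ) (hk : 0 < k)
    (hkα : 2 * k ≤ Fintype.card α) (hH₀ : 0 < H₀) (hb : ∀ j a, |h j a| ≤ H₀)
    (hr : ∀ j, 𝔼 a, h j a ^ 2 ≤ r) (hx : 0 < x) {c : ℝ} (hc : 2 ≤ c) :
    1 - Real.exp (-x) ≤ μ.real {ω | (⨆ j, 𝔼 a ∈ S ω, h j a) - ∫ ω', ⨆ j, 𝔼 a ∈ S ω', h j a ∂μ ≤
      c * (2 * √(3 * r * x / k) + (⨅ α : Set.Ioi (0 : ℝ),
        (subsetComplexity S μ (fun j a => h j a ^ 2) / (α : ℝ) + (α : ℝ) * x / k)) +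
          H₀ * x / k)} := by
  have hsq₀ (j : κ) : 0 ≤ 𝔼 a, h j a ^ 2 := expect_nonneg fun a _ => sq_nonneg _
  have hr₀ : 0 ≤ r := (hsq₀ (Classical.arbitrary κ)).trans (hr _)
  have hR := hS.subsetComplexity_nonneg hk (by omega)
    (fun j a => sq_le_sq.2 ((hb j a).trans (le_abs_self _))) hsq₀
  have htail := hS.measureReal_iSup_expect_ge_le hk hkα hH₀ hb hr hx
  have hinf := two_mul_sqrt_le_iInf hR (show 0 ≤ x / k by positivity)
  simp only [← mul_div_assoc] at hinf
  set R := subsetComplexity S μ fun j a => h j a ^ 2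
  set I := ⨅ α : Set.Ioi (0 : ℝ), (R / (α : ℝ) + (α : ℝ) * x / k)
  set s := {ω | ∫ ω', ⨆ j, 𝔼 a ∈ S ω', h j a ∂μ +
    (2 * √(2 / k * (R + 3 * r) * x) + 2 * H₀ / k * x) ≤ ⨆ j, 𝔼 a ∈ S ω, h j a}
  have hsqrt : √(2 / k * (R + 3 * r) * x) ≤ 2 * (√(3 * r * x / k)) + 2 * √(R * x / k) := by
    rw [Real.sqrt_le_left (by positivity)]
    have hRx := Real.sq_sqrt (show 0 ≤ R * x / k by positivity)
    have hrx := Real.sq_sqrt (show 0 ≤ 3 * r * x / k by positivity)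
    have hexpand : 2 / k * (R + 3 * r) * x = 2 * (R * x / k) + 2 * (3 * r * x / k) := by ring
    nlinarith [Real.sqrt_nonneg (R * x / k), Real.sqrt_nonneg (3 * r * x / k)]
  have hcompl : μ.real sᶜ = 1 - μ.real s :=
    probReal_compl_eq_one_sub (Set.toFinite s).measurableSet
  refine (sub_le_sub_left htail 1).trans (hcompl.symm.trans_le (measureReal_mono fun ω hω => ?_))
  have hω := (not_le (α := ℝ)).1 hω
  have hβ : 2 * H₀ / k * x = 2 * (H₀ * x / k) := by ring
  have hI : 0 ≤ I := (mul_nonneg two_pos.le (Real.sqrt_nonneg _)).trans hinf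
  have hW : 2 * (2 * √(3 * r * x / k) + I + H₀ * x / k) ≤
      c * (2 * √(3 * r * x / k) + I + H₀ * x / k) := by gcongr
  rw [Set.mem_ofPred_eq]
  linarith

end Supremum

end UniformSubset

section Draws

theorem expect_comp_mulActionHom_eq_expect_smul {G D B : Type*} [Group G] [Fintype G]
    [MulAction G D] [MulAction G B] [MulAction.IsPretransitive G B] [Fintype D] [Nonempty D]
    (φ : D →[G] B) (F : B → ℝ) (b : B) : 𝔼 d, F (φ d) = 𝔼 g : G, F (g • b) := by
  have horbit (d : D) : 𝔼 g : G, F (g • φ d) = 𝔼 g : G, F (g • b) := by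
    obtain ⟨g₀, hg₀⟩ := MulAction.exists_smul_eq G b (φ d)
    exact Fintype.expect_equiv (Equiv.mulRight g₀) _ _ fun g => by simp [mul_smul, hg₀]
  calc
    _ = 𝔼 g : G, 𝔼 d, F (φ (g • d)) := by
      rw [expect_congr rfl fun g _ => Fintype.expect_equiv (MulAction.toPerm g)
        (fun d => F (φ (g • d))) (fun d => F (φ d)) fun _ => rfl, Fintype.expect_const]
    _ = 𝔼 d, 𝔼 g : G, F (g • φ d) := by
      simp only [map_smul]
      exact expect_comm _ _ _
    _ = _ := by rw [expect_congr rfl fun d _ => horbit d, Fintype.expect_const]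

theorem expect_map_embedding {α : Type*} [Fintype α] {k : ℕ} [Nonempty (Fin k ↪ α)]
    (F : Finset α → ℝ) : 𝔼 e : Fin k ↪ α, F (univ.map e) = 𝔼 T ∈ univ.powersetCard k, F T := by
  classical
  have := Set.powersetCard.isPretransitive (α := α) (n := k)
  have : Nonempty (Set.powersetCard α k) :=
    .map (Set.powersetCard.mulActionHom_of_embedding (Equiv.Perm α) α k) inferInstance
  have := Fintype.ofFinite (Set.powersetCard α k)
  have T₀ := Classical.arbitrary (Set.powersetCard α k)
  calc
    _ = 𝔼 σ : Equiv.Perm α, F (σ • T₀ : Set.powersetCard α k) :=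
      expect_comp_mulActionHom_eq_expect_smul
        (Set.powersetCard.mulActionHom_of_embedding (Equiv.Perm α) α k) (fun T => F T.1) T₀
    _ = 𝔼 T : Set.powersetCard α k, F T :=
      (expect_comp_mulActionHom_eq_expect_smul (.id (Equiv.Perm α)) (fun T => F T.1) T₀).symm
    _ = _ := expect_bij (fun T _ => T.1) (by simp) (by simp)
      (fun _ _ _ _ h => Subtype.ext h) fun T hT => ⟨⟨T, (mem_powersetCard.1 hT).2⟩, by simp⟩

variable {m u : ℕ}

theorem randPermArray_succ (d : Draws m u) (i : Fin u) :
    randPermArray d (i + 1) = randPermArray d i *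
      Equiv.swap (Fin.castLE (Nat.le_add_left u m) i) (d i).1 := by
  rw [randPermArray, dif_pos i.2]

theorem randPermArray_castLE_of_lt (d : Draws m u) (i : Fin u) {l : ℕ} (hil : i < l) (hlu : l ≤ u) :
    randPermArray d l (Fin.castLE (Nat.le_add_left u m) i) = randPerm d i := by
  induction l, hil using Nat.le_induction with
  | base =>
    rw [Nat.succ_eq_add_one, randPermArray_succ, Equiv.Perm.mul_apply, Equiv.swap_apply_left,
      randPerm]
  | succ l hl ih =>
    have hround := randPermArray_succ d ⟨l, by omega⟩
    have hdraw : l ≤ ((d ⟨l, by omega⟩).1 : ℕ) := (d ⟨l, by omega⟩).2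
    rw [hround, Equiv.Perm.mul_apply, Equiv.swap_apply_of_ne_of_ne, ih (by omega)]
    all_goals
      refine Fin.ne_of_val_ne ?_
      simp only [Fin.val_castLE]
      omega

theorem randPerm_injective (d : Draws m u) : Function.Injective (randPerm d) := by
  intro i j h
  rw [← randPermArray_castLE_of_lt d i i.2 le_rfl, ← randPermArray_castLE_of_lt d j j.2 le_rfl] at h
  exact Fin.castLE_injective _ ((randPermArray d u).injective h)

/-- The output of RANDPERM as an embedding, that is as a sequence of distinct indices. -/
def randPermEmb (d : Draws m u) : Fin u ↪ Fin (m + u) :=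
  ⟨randPerm d, randPerm_injective d⟩

theorem eq_of_randPerm_eq {d d' : Draws m u} {i : Fin u}
    (harray : randPermArray d i = randPermArray d' i) (h : randPerm d i = randPerm d' i) :
    d i = d' i := by
  rw [randPerm, randPerm, harray] at h
  exact Subtype.ext ((randPermArray d' i).injective h)

theorem randPermEmb_injective :
    Function.Injective (randPermEmb : Draws m u → (Fin u ↪ Fin (m + u))) := by
  intro d d' h
  have hperm (i : Fin u) : randPerm d i = randPerm d' i := DFunLike.congr_fun h i
  have harray (k : ℕ) (hk : k ≤ u) : randPermArray d k = randPermArray d' k := by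
    induction k with
    | zero => rfl
    | succ k ih =>
      have hk' := ih (by omega)
      rw [randPermArray_succ d ⟨k, hk⟩, randPermArray_succ d' ⟨k, hk⟩, hk',
        eq_of_randPerm_eq hk' (hperm ⟨k, hk⟩)]
  exact funext fun i => eq_of_randPerm_eq (harray i i.2.le) (hperm i)

theorem card_draws (m u : ℕ) : Fintype.card (Draws m u) = (m + u).descFactorial u := by
  rw [Fintype.card_pi, Nat.descFactorial_eq_prod_range,
    ← Fin.prod_univ_eq_prod_range (fun i => m + u - i)]
  refine prod_congr rfl fun i _ => ?_
  rw [Fintype.card_subtype, filter_le_eq_Ici, Fin.card_Ici, Fin.val_castLE]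

theorem randPermEmb_bijective :
    Function.Bijective (randPermEmb : Draws m u → (Fin u ↪ Fin (m + u))) := by
  refine (Fintype.bijective_iff_injective_and_card _).2 ⟨randPermEmb_injective, ?_⟩
  rw [card_draws, Fintype.card_embedding_eq, Fintype.card_fin, Fintype.card_fin]

theorem testIdx_eq_map (d : Draws m u) : testIdx d = univ.map (randPermEmb d) := by
  rw [map_eq_image, testIdx, randPermEmb, Function.Embedding.coeFn_mk]

theorem card_testIdx (d : Draws m u) : #(testIdx d) = u := by
  rw [testIdx_eq_map, card_map, card_univ, Fintype.card_fin]

theorem card_trainIdx (d : Draws m u) : #(trainIdx d) = m := by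
  rw [trainIdx, card_compl, card_testIdx, Fintype.card_fin, Nat.add_sub_cancel]

theorem drawLaw_real_singleton (d : Draws m u) :
    (drawLaw m u).real {d} = (Fintype.card (Draws m u) : ℝ)⁻¹ := by
  have (i : Fin u) : IsProbabilityMeasure (uniformOn (Set.univ : Set {k : Fin (m + u) //
      Fin.castLE (Nat.le_add_left u m) i ≤ k})) :=
    isProbabilityMeasure_uniformOn Set.finite_univ ⟨⟨_, le_rfl⟩, Set.mem_univ _⟩
  rw [measureReal_def, drawLaw, Measure.pi_singleton, ENNReal.toReal_prod, Fintype.card_pi,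
    Nat.cast_prod, ← prod_inv_distrib]
  refine prod_congr rfl fun i _ => ?_
  rw [uniformOn_univ, Measure.count_singleton, one_div, ENNReal.toReal_inv, ENNReal.toReal_natCast]

theorem integral_drawLaw (f : Draws m u → ℝ) : ∫ d, f d ∂(drawLaw m u) = 𝔼 d, f d := by
  rw [integral_fintype .of_finite, Fintype.expect_eq_sum_div_card, sum_div]
  refine sum_congr rfl fun d _ => ?_
  rw [drawLaw_real_singleton, smul_eq_mul, inv_mul_eq_div]

theorem isUniformSubset_testIdx : IsUniformSubset testIdx u (drawLaw m u) := by
  have : Nonempty (Fin u ↪ Fin (m + u)) := ⟨Fin.natAddEmb m⟩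
  intro f
  rw [integral_drawLaw, ← expect_map_embedding]
  exact Fintype.expect_bijective _ randPermEmb_bijective _ _ fun d => by rw [testIdx_eq_map]

theorem isUniformSubset_trainIdx : IsUniformSubset trainIdx m (drawLaw m u) :=
  isUniformSubset_testIdx.compl (by rw [Fintype.card_fin, add_comm])

end Draws

section Deviation

variable {S : Type*} {m u : ℕ} {z : Fin (m + u) → S} {H : Set (S → ℝ)} {H₀ r x : ℝ}

theorem iSup_squareClass (H : Set (S → ℝ)) (F : (S → ℝ) → ℝ) :
    ⨆ f : squareClass H, F f.1 = ⨆ h : H, F (fun p => h.1 p ^ 2) := by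
  have hsurj : Function.Surjective
      (fun h : H => (⟨fun p => h.1 p ^ 2, h.1, h.2, rfl⟩ : squareClass H)) := by
    rintro ⟨f, h, hh, rfl⟩
    exact ⟨⟨h, hh⟩, rfl⟩
  exact (hsurj.iSup_comp (fun f : squareClass H => F f.1)).symm

theorem fullAvg_eq_expect (z : Fin (m + u) → S) (h : S → ℝ) : fullAvg z h = 𝔼 a, h (z a) := by
  rw [fullAvg, Fintype.expect_eq_sum_div_card, Fintype.card_fin, one_div_mul_eq_div]

theorem fullSqAvg_eq_expect (z : Fin (m + u) → S) (h : S → ℝ) :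
    fullSqAvg z h = 𝔼 a, h (z a) ^ 2 :=
  fullAvg_eq_expect z fun p => h p ^ 2

theorem testAvg_eq_expect (z : Fin (m + u) → S) (d : Draws m u) (h : S → ℝ) :
    testAvg z d h = 𝔼 a ∈ testIdx d, h (z a) := by
  rw [testAvg, expect_eq_sum_div_card, card_testIdx, one_div_mul_eq_div]

theorem trainAvg_eq_expect (z : Fin (m + u) → S) (d : Draws m u) (h : S → ℝ) :
    trainAvg z d h = 𝔼 a ∈ trainIdx d, h (z a) := by
  rw [trainAvg, expect_eq_sum_div_card, card_trainIdx, one_div_mul_eq_div]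

theorem testComplexity_squareClass (z : Fin (m + u) → S) (H : Set (S → ℝ)) :
    testComplexity z (squareClass H) =
      subsetComplexity testIdx (drawLaw m u) fun (h : H) a => h.1 (z a) ^ 2 := by
  simp only [testComplexity, subsetComplexity, testAvg_eq_expect, fullAvg_eq_expect]
  exact integral_congr_ae (.of_forall fun d =>
    iSup_squareClass H fun f => 𝔼 a ∈ testIdx d, f (z a) - 𝔼 a, f (z a))

theorem trainComplexity_squareClass (z : Fin (m + u) → S) (H : Set (S → ℝ)) :
    trainComplexity z (squareClass H) =
      subsetComplexity trainIdx (drawLaw m u) fun (h : H) a => h.1 (z a) ^ 2 := by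
  simp only [trainComplexity, subsetComplexity, trainAvg_eq_expect, fullAvg_eq_expect]
  exact integral_congr_ae (.of_forall fun d =>
    iSup_squareClass H fun f => 𝔼 a ∈ trainIdx d, f (z a) - 𝔼 a, f (z a))

theorem card_mul_testAvg_add_card_mul_trainAvg (hm : 0 < m) (hu : 0 < u) (z : Fin (m + u) → S)
    (d : Draws m u) (h : S → ℝ) :
    u * testAvg z d h + m * trainAvg z d h = (m + u : ℕ) * fullAvg z h := by
  rw [testAvg, trainAvg, fullAvg, ← sum_add_sum_compl (testIdx d), trainIdx]
  field_simp

theorem supTest_eq_mul_iSup_neg (hm : 0 < m) (hu : 0 < u) (hzero : ∀ h ∈ H, fullAvg z h = 0)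
    (d : Draws m u) : supTest z H d = m / u * ⨆ h : H, 𝔼 a ∈ trainIdx d, -h.1 (z a) := by
  rw [supTest, Real.mul_iSup_of_nonneg (by positivity)]
  refine iSup_congr fun h => ?_
  have hbalance := card_mul_testAvg_add_card_mul_trainAvg hm hu z d h.1
  rw [hzero h.1 h.2, mul_zero] at hbalance
  rw [expect_neg_distrib, ← trainAvg_eq_expect, div_mul_eq_mul_div, eq_div_iff (by positivity)]
  linarith

theorem one_sub_exp_neg_le_supTest_sub_integral_le_of_le (hu : 0 < u) (hum : u ≤ m)
    (hH : H.Nonempty) (hH₀ : 0 < H₀) (hbound : ∀ h ∈ H, ∀ i, |h (z i)| ≤ H₀)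
    (hr : ∀ h ∈ H, fullSqAvg z h ≤ r) (hx : 0 < x) :
    1 - Real.exp (-x) ≤ (drawLaw m u).real
      {d | supTest z H d - ∫ d', supTest z H d' ∂(drawLaw m u) ≤
        4 * (m : ℝ) / (m + u : ℕ) * (2 * √(3 * r * x / u) + (⨅ α : Set.Ioi (0 : ℝ),
          (testComplexity z (squareClass H) / (α : ℝ) + (α : ℝ) * x / u)) + H₀ * x / u)} := by
  have := hH.to_subtype
  have hratio : 2 ≤ 4 * (m : ℝ) / (m + u : ℕ) := by
    rw [le_div_iff₀ (by positivity)]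
    exact_mod_cast (by omega : 2 * (m + u) ≤ 4 * m)
  have hdev := isUniformSubset_testIdx.one_sub_exp_neg_le_measureReal_iSup_expect_sub_le hu
    (h := fun (h : H) a => h.1 (z a)) (by rw [Fintype.card_fin]; omega) hH₀
    (fun h => hbound h.1 h.2) (fun h => by simpa only [← fullSqAvg_eq_expect] using hr h.1 h.2)
    hx hratio
  simpa only [supTest, testAvg_eq_expect, testComplexity_squareClass] using hdev

theorem one_sub_exp_neg_le_supTest_sub_integral_le_of_ge (hm : 0 < m) (hmu : m ≤ u)
    (hH : H.Nonempty) (hH₀ : 0 < H₀) (hzero : ∀ h ∈ H, fullAvg z h = 0)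
    (hbound : ∀ h ∈ H, ∀ i, |h (z i)| ≤ H₀) (hr : ∀ h ∈ H, fullSqAvg z h ≤ r) (hx : 0 < x) :
    1 - Real.exp (-x) ≤ (drawLaw m u).real
      {d | supTest z H d - ∫ d', supTest z H d' ∂(drawLaw m u) ≤
        4 * (m : ℝ) / (m + u : ℕ) * (2 * √(3 * r * x / m) + (⨅ α : Set.Ioi (0 : ℝ),
          (trainComplexity z (squareClass H) / (α : ℝ) + (α : ℝ) * x / m)) + H₀ * x / m)} := by
  have := hH.to_subtype
  have hu : 0 < u := hm.trans_le hmu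
  have hratio : 2 ≤ 4 * (u : ℝ) / (m + u : ℕ) := by
    rw [le_div_iff₀ (by positivity)]
    exact_mod_cast (by omega : 2 * (m + u) ≤ 4 * u)
  have hscale : 4 * (m : ℝ) / (m + u : ℕ) = m / u * (4 * u / (m + u : ℕ)) := by field_simp
  have hdev := isUniformSubset_trainIdx.one_sub_exp_neg_le_measureReal_iSup_expect_sub_le hm
    (h := fun (h : H) a => -h.1 (z a)) (by rw [Fintype.card_fin]; omega) hH₀
    (fun h a => by rw [abs_neg]; exact hbound h.1 h.2 a)
    (fun h => by simpa only [neg_sq, ← fullSqAvg_eq_expect] using hr h.1 h.2) hx hratio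
  simp only [neg_sq] at hdev
  simpa only [supTest_eq_mul_iSup_neg hm hu hzero, integral_const_mul, ← mul_sub, hscale, mul_assoc,
    mul_le_mul_iff_right₀ (show (0 : ℝ) < m / u by positivity), trainComplexity_squareClass]
    using hdev

end Deviation

end Transductive

end

theorem mainTheorem5_general {S : Type*} (m u : ℕ) (hm : 0 < m) (hu : 0 < u)
    (z : Fin (m + u) → S) (H : Set (S → ℝ)) (hH : H.Nonempty)
    (H₀ : ℝ) (hH₀ : 0 < H₀)
    (hzero : m < u → ∀ h ∈ H, Transductive.fullAvg z h = 0)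
    (hbound : ∀ h ∈ H, ∀ i, |h (z i)| ≤ H₀)
    (r : ℝ) (hr : ∀ h ∈ H, Transductive.fullSqAvg z h ≤ r)
    (x : ℝ) (hx : 0 < x) :
    1 - Real.exp (-x) ≤
      (Transductive.drawLaw m u).real
        {d | Transductive.supTest z H d
              - ∫ d', Transductive.supTest z H d' ∂(Transductive.drawLaw m u) ≤
            (4 * (m : ℝ) / ((m + u : ℕ) : ℝ)) *
              (2 * √(3 * r * x / ((min u m : ℕ) : ℝ))
                + (⨅ α : Set.Ioi (0 : ℝ),
                    (Transductive.minComplexity z (Transductive.squareClass H) / (α : ℝ)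
                      + (α : ℝ) * x / ((min u m : ℕ) : ℝ)))
                + H₀ * x / ((min u m : ℕ) : ℝ))} := by
  rcases le_or_gt u m with hum | hmu
  · rw [min_eq_left hum, Transductive.minComplexity, if_pos hum]
    exact Transductive.one_sub_exp_neg_le_supTest_sub_integral_le_of_le hu hum hH hH₀ hbound hr hx
  · rw [min_eq_right hmu.le, Transductive.minComplexity, if_neg hmu.not_ge]
    exact Transductive.one_sub_exp_neg_le_supTest_sub_integral_le_of_ge hm hmu.le hH hH₀
      (hzero hmu) hbound hr hx

theorem mainTheorem5 {𝒳 𝒴 : Type*} (m u : ℕ) (hm : 0 < m) (hu : 0 < u)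
    (z : Fin (m + u) → 𝒳 × 𝒴) (H : Set (𝒳 × 𝒴 → ℝ)) (hH : H.Nonempty)
    (H₀ : ℝ) (hH₀ : 2 * √2 ≤ H₀)
    (hzero : ∀ h ∈ H, Transductive.fullAvg z h = 0)
    (hbound : ∀ h ∈ H, ∀ i, |h (z i)| ≤ H₀)
    (r : ℝ) (hr : ∀ h ∈ H, Transductive.fullSqAvg z h ≤ r)
    (x : ℝ) (hx : 0 < x) :
    1 - Real.exp (-x) ≤
      (Transductive.drawLaw m u).real
        {d | Transductive.supTest z H d
              - ∫ d', Transductive.supTest z H d' ∂(Transductive.drawLaw m u) ≤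
            (4 * (m : ℝ) / ((m + u : ℕ) : ℝ)) *
              (2 * √(3 * r * x / ((min u m : ℕ) : ℝ))
                + (⨅ α : Set.Ioi (0 : ℝ),
                    (Transductive.minComplexity z (Transductive.squareClass H) / (α : ℝ)
                      + (α : ℝ) * x / ((min u m : ℕ) : ℝ)))
                + 2 * H₀ ^ 2 * x / ((min u m : ℕ) : ℝ))} := by
  have hH₁ : 1 ≤ H₀ := (one_le_mul_of_one_le_of_one_le one_le_two
    (Real.one_le_sqrt.2 one_le_two)).trans hH₀
  refine (mainTheorem5_general m u hm hu z H hH H₀ (one_pos.trans_le hH₁) (fun _ => hzero) hbound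
    r hr x hx).trans (measureReal_mono fun d hd => ?_)
  rw [Set.mem_ofPred_eq] at hd ⊢
  refine hd.trans ?_
  gcongr
  nlinarith
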